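/- Let $p$ be an odd prime and $n\ge 1$. For a group $G$ let $1=Z_0(G)\le Z_1(G)\le\cdots$ be its upper central series and $G=\gamma_1(G)\ge\gamma_2(G)\ge\cdots$ its lower central series. (1) Let $P$ be a Sylow $p$-subgroup of $\operatorname{Sym}(p^n)$. Then the upper and the lower central series of $P$ coincide: $P$ is nilpotent of class exactly $p^{n-1}$, and $$Z_i(P)=\gamma_{p^{n-1}+1-i}(P)\qquad\text{for } 0\le i\le p^{n-1}.$$ (2) For $1\le k\le n$ and a function $f\colon\mathbb F_p^{k-1}\to\mathbb F_p$ let $f\Delta_k$ be the permutation $x\mapsto x-f(x_1,\dots,x_{k-1})\,e_k$ of $\mathbb F_p^n$. Let $B_k$ be the group of all $f\Delta_k$ ($k$ fixed), and let $W_n=\langle B_1,\dots,B_n\rangle\cong\wr^n\mathbb F_p$. Then $W_n$ is a Sylow $p$-subgroup of $\operatorname{Sym}(\mathbb F_p^n)$. For a monomial $x^\Lambda=x_1^{\lambda_1}\cdots x_{k-1}^{\lambda_{k-1}}$ with $0\le\lambda_j\le p-1$ put $$\operatorname{pdeg}(x^\Lambda\Delta_k)=\sum_{j=1}^{k-1}\lambda_j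 p^{j-1}+p^{n-1}-p^{k-1}.$$ Then for $0\le i\le p^{n-1}$ $$Z_i(W_n)=\gamma_{p^{n-1}+1-i}(W_n)=\langle x^\Lambda\Delta_k : 1\le k\le n,\ \operatorname{pdeg}(x^\Lambda\Delta_k)\le i-1\rangle,$$ and for every $1\le k\le n$ $$Z_i(W_n)\cap B_k=\langle x^\Lambda\Delta_k : \operatorname{pdeg}(x^\Lambda\Delta_k)\le i-1\rangle .$$ -/

import Mathlib

namespace SylowCentral

/-- For `k : Fin n` (the coordinates of `𝔽_p ^ n` are numbered from `0`) and a function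
`f` of the coordinates preceding `k`, the permutation `f Δ_k` of `𝔽_p ^ n`, which sends `x` to
`x - f(x_0, …, x_{k-1}) e_k`. It depends homomorphically on `f`. -/
def delta (p : ℕ) {n : ℕ} (k : Fin n) :
    Multiplicative ((Fin k → ZMod p) → ZMod p) →* Equiv.Perm (Fin n → ZMod p) where
  toFun f :=
    { toFun := fun x => Function.update x k
        (x k - Multiplicative.toAdd f (fun j : Fin k => x (Fin.castLE k.isLt.le j)))
      invFun := fun x => Function.update x k
        (x k + Multiplicative.toAdd f (fun j : Fin k => x (Fin.castLE k.isLt.le j)))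
      left_inv := fun x => by
        have h : ∀ j : Fin k, Fin.castLE k.isLt.le j ≠ k := fun j hj =>
          absurd (congrArg Fin.val hj) (Nat.ne_of_lt j.isLt)
        simp [Function.update_of_ne (h _)]
      right_inv := fun x => by
        have h : ∀ j : Fin k, Fin.castLE k.isLt.le j ≠ k := fun j hj =>
          absurd (congrArg Fin.val hj) (Nat.ne_of_lt j.isLt)
        simp [Function.update_of_ne (h _)] }
  map_one' := by
    ext x : 1
    simp
  map_mul' f g := by
    have h : ∀ j : Fin k, Fin.castLE k.isLt.le j ≠ k := fun j hj =>
      absurd (congrArg Fin.val hj) (Nat.ne_of_lt j.isLt)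
    ext x : 1
    simp [Function.update_of_ne (h _), sub_sub, add_comm]

/-- The base subgroup of all `f Δ_k`, for a fixed `k`. -/
def baseSubgroup (p : ℕ) {n : ℕ} (k : Fin n) : Subgroup (Equiv.Perm (Fin n → ZMod p)) :=
  (delta p k).range

/-- The iterated wreath product `W_n = ≀ⁿ 𝔽_p` in its action on `𝔽_p ^ n`:
the group generated by the base subgroups. -/
def W (p n : ℕ) : Subgroup (Equiv.Perm (Fin n → ZMod p)) :=
  ⨆ k : Fin n, baseSubgroup p k

/-- The element `x^Λ Δ_k` for the power monomial `x^Λ = ∏_{j < k} x_j ^ λ_j`, with exponents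
`0 ≤ λ_j ≤ p - 1`. -/
def monomialElt (p : ℕ) {n : ℕ} (k : Fin n) (Λ : Fin k → Fin p) :
    Equiv.Perm (Fin n → ZMod p) :=
  delta p k (Multiplicative.ofAdd fun x => ∏ j, x j ^ (Λ j : ℕ))

/-- The `p`-degree of `x^Λ Δ_k`. As coordinates are numbered from `0`, the variable `x_j` has
`p`-degree `p ^ j`, and `Δ_k` has `p`-degree `p ^ (n - 1) - p ^ k` (here `k ≤ n - 1`). -/
def pdeg (p : ℕ) {n : ℕ} (k : Fin n) (Λ : Fin k → Fin p) : ℕ :=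
  (∑ j, (Λ j : ℕ) * p ^ (j : ℕ)) + (p ^ (n - 1) - p ^ (k : ℕ))

end SylowCentral

/-!
An element `w` of the wreath product is determined by its displacements `x ↦ x_k - w(x)_k`, which
may be arbitrary functions of the coordinates before `x_k`. Give `x_j` the degree `p ^ j`, and let
`filt p n d` be the space of functions of degree `< d` on `𝔽_p ^ n`. As each exponent may be reduced
below `p`, expansion in base `p` shows that there is exactly one reduced monomial in each degree
below `p ^ n`, and that `filt p n (p ^ k)` consists of the functions of `x_0, …, x_{k-1}`.
Thus the wreath product is the set of all permutations whose `k`-th displacement has degree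
`< p ^ k`, and requiring the degree `< p ^ k - s` defines a descending series
`weightSubgroup p n s`, generated by the elements `x ^ Λ Δ_k` of `p`-degree `< p ^ (n - 1) - s`.
It reaches the trivial group for `s = p ^ (n - 1)` and not before.

Both central series coincide with this series.
* Composition with an element of `weightSubgroup p n s` lowers degrees by at least `1 + s`
  (`comp_sub_mem`), and commutators are given, up to composition with a permutation, by such
  differences (`commutator_mem_weightSubgroup_iff`). Hence the series is central.
* If `j` is the position of the lowest nonzero digit of `d + 1`, then the difference of the monomial
  of degree `d + 1` under `x_j ↦ x_j - x_0 ^ (p - 1) ⋯ x_{j-1} ^ (p - 1)` has as its leading term a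
  nonzero multiple of the monomial of degree `d` (`exists_leading_term`). So commutators with these
  shears fill the next term of the series (`weightSubgroup_le_commutator`), which gives the lower
  central series.
* For the same reason such a commutator detects every leading term of positive degree in a
  displacement. A constant displacement of `x_k` is detected by the commutator with
  `x_0 ^ (p - 1) ⋯ x_{n-2} ^ (p - 1) Δ_{n-1}`, as long as `k < n - 1`. This gives the upper central
  series (`mem_weightSubgroup_succ`).

The order of the wreath product is `p ^ (1 + p + ⋯ + p ^ (n - 1))`, the `p`-part of `(p ^ n)!`, so
it is a Sylow subgroup of the symmetric group, and the statement for all Sylow `p`-subgroups of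
`Sym(p ^ n)` follows as these are isomorphic.
-/

namespace SylowCentral

open scoped commutatorElement

variable {p n : ℕ}

/-! ### The degree filtration on functions -/

/-- The `p`-degree `∑ e_j p ^ j` of an exponent vector (coordinates are numbered from `0`). -/
def wt (p : ℕ) {n : ℕ} (e : Fin n → ℕ) : ℕ := ∑ j, e j * p ^ (j : ℕ)

/-- The monomial `x ^ e`, as a function on `𝔽_p ^ n`. The exponents are not bounded by `p - 1`. -/
def mono (p : ℕ) {n : ℕ} (e : Fin n → ℕ) : (Fin n → ZMod p) → ZMod p := fun x => ∏ j, x j ^ e j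

/-- The functions on `𝔽_p ^ n` of `p`-degree `< d`: the span of the monomials of `p`-degree `< d`.
For `d ≤ p ^ k` only the coordinates `x_j` with `j < k` occur in these monomials. -/
def filt (p n d : ℕ) : Submodule (ZMod p) ((Fin n → ZMod p) → ZMod p) :=
  Submodule.span (ZMod p) {g | ∃ e : Fin n → ℕ, wt p e < d ∧ mono p e = g}

theorem filt_le {d d' : ℕ} (h : d ≤ d') : filt p n d ≤ filt p n d' :=
  Submodule.span_mono fun _ ⟨e, he, h'⟩ => ⟨e, he.trans_le h, h'⟩

theorem filt_zero : filt p n 0 = ⊥ := by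
  simp [filt]

theorem mono_mem_filt {e : Fin n → ℕ} {d : ℕ} (h : wt p e < d) : mono p e ∈ filt p n d :=
  Submodule.subset_span ⟨e, h, rfl⟩

theorem mono_mul_mono (e e' : Fin n → ℕ) : mono p e * mono p e' = mono p (e + e') := by
  ext x
  simp [mono, pow_add, Finset.prod_mul_distrib]

theorem wt_add (e e' : Fin n → ℕ) : wt p (e + e') = wt p e + wt p e' := by
  simp [wt, add_mul, Finset.sum_add_distrib]

theorem mul_mem_filt {a b : ℕ} {f g : (Fin n → ZMod p) → ZMod p}
    (hf : f ∈ filt p n a) (hg : g ∈ filt p n (b + 1)) : f * g ∈ filt p n (a + b) := by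
  have h := Submodule.mul_mem_mul hf hg
  rw [filt, filt, Submodule.span_mul_span] at h
  refine Submodule.span_mono ?_ h
  rintro _ ⟨_, ⟨e, he, rfl⟩, _, ⟨e', he', rfl⟩, rfl⟩
  exact ⟨e + e', by rw [wt_add]; omega, (mono_mul_mono e e').symm⟩

theorem mono_zero : mono p (0 : Fin n → ℕ) = 1 := by
  ext x
  simp [mono]

theorem mono_single (j : Fin n) (m : ℕ) : mono p (Pi.single j m) = fun x => x j ^ m := by
  ext x
  rw [mono, Finset.prod_eq_single j] <;> simp +contextual

theorem wt_single (j : Fin n) (m : ℕ) : wt p (Pi.single j m) = m * p ^ (j : ℕ) := by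
  rw [wt, Finset.sum_eq_single j] <;> simp +contextual

theorem const_mem_filt {d : ℕ} (hd : 0 < d) (c : ZMod p) :
    (fun _ => c : (Fin n → ZMod p) → ZMod p) ∈ filt p n d := by
  have h : mono p (0 : Fin n → ℕ) ∈ filt p n d := mono_mem_filt (by simpa [wt] using hd)
  have h' := (filt p n d).smul_mem c h
  rw [mono_zero] at h'
  convert h' using 1
  ext x
  simp

theorem one_mem_filt {d : ℕ} (hd : 0 < d) : (1 : (Fin n → ZMod p) → ZMod p) ∈ filt p n d :=
  const_mem_filt hd 1

theorem coord_mem_filt (j : Fin n) :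
    (fun x => x j : (Fin n → ZMod p) → ZMod p) ∈ filt p n (p ^ (j : ℕ) + 1) := by
  have h : mono p (Pi.single j 1) ∈ filt p n (p ^ (j : ℕ) + 1) :=
    mono_mem_filt (by simp [wt_single])
  simpa [mono_single] using h

theorem pow_mem_filt {a : ℕ} {f : (Fin n → ZMod p) → ZMod p} (hf : f ∈ filt p n (a + 1)) (m : ℕ) :
    f ^ m ∈ filt p n (m * a + 1) := by
  induction m with
  | zero => simpa using one_mem_filt (p := p) (n := n) Nat.one_pos
  | succ m ih =>
    have := mul_mem_filt ih hf
    rw [← pow_succ] at this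
    convert this using 2
    ring

theorem prod_mem_filt {ι : Type*} (s : Finset ι) (a : ι → ℕ) (f : ι → (Fin n → ZMod p) → ZMod p)
    (hf : ∀ i ∈ s, f i ∈ filt p n (a i + 1)) : ∏ i ∈ s, f i ∈ filt p n (∑ i ∈ s, a i + 1) := by
  classical
  induction s using Finset.induction_on with
  | empty => simpa using one_mem_filt (p := p) (n := n) Nat.one_pos
  | insert i s hi ih =>
    rw [Finset.prod_insert hi, Finset.sum_insert hi]
    have h0 := mul_mem_filt (ih fun j hj => hf j (by simp [hj])) (hf i (by simp))
    rw [mul_comm] at h0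
    convert h0 using 2
    ring

/-! ### Composition with a triangular permutation -/

/-- The displacement `x ↦ x_k - w(x)_k` of a permutation in the `k`-th coordinate. For
`w = f Δ_k` it is `f` in the `k`-th coordinate and zero in all others. -/
def disp (w : Equiv.Perm (Fin n → ZMod p)) (k : Fin n) : (Fin n → ZMod p) → ZMod p :=
  fun x => x k - w x k

/-- The case of monomials in `comp_sub_mem`. The property `Q a g`, that `g` has degree at most `a`
and `g ∘ w - g` degree less than `a - s`, is inherited by products, so it suffices to know it for
the coordinate functions. -/
theorem mono_comp_sub_mem {w : Equiv.Perm (Fin n → ZMod p)} {s : ℕ}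
    (hw : ∀ j : Fin n, disp w j ∈ filt p n (p ^ (j : ℕ) - s)) (e : Fin n → ℕ) :
    mono p e ∘ w - mono p e ∈ filt p n (wt p e - s) := by
  let Q : ℕ → ((Fin n → ZMod p) → ZMod p) → Prop := fun a g =>
    g ∈ filt p n (a + 1) ∧ g ∘ w - g ∈ filt p n (a - s)
  have hmul : ∀ {a b g h}, Q a g → Q b h → Q (a + b) (g * h) := by
    rintro a b g h ⟨hg, hg'⟩ ⟨hh, hh'⟩
    have hhw : h ∘ w ∈ filt p n (b + 1) := by
      have := (filt p n (b + 1)).add_mem (filt_le (by omega : b - s ≤ b + 1) hh') hh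
      simpa using this
    refine ⟨by simpa [add_right_comm] using mul_mem_filt hg hh, ?_⟩
    have e1 : (g * h) ∘ w - g * h = (g ∘ w - g) * h ∘ w + (h ∘ w - h) * g := by
      ext x
      simp
      ring
    rw [e1]
    refine Submodule.add_mem _ ?_ ?_
    · rcases le_total a s with has | has
      · rw [Nat.sub_eq_zero_of_le has, filt_zero, Submodule.mem_bot] at hg'
        simp [hg']
      · exact filt_le (by omega) (mul_mem_filt hg' hhw)
    · rcases le_total b s with has | has
      · rw [Nat.sub_eq_zero_of_le has, filt_zero, Submodule.mem_bot] at hh'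
        simp [hh']
      · exact filt_le (by omega) (mul_mem_filt hh' hg)
  have hone : Q 0 1 := by
    refine ⟨one_mem_filt (by omega), ?_⟩
    have : (1 : (Fin n → ZMod p) → ZMod p) ∘ w - 1 = 0 := by ext; simp
    rw [this]
    exact Submodule.zero_mem _
  have hcoord : ∀ j : Fin n, Q (p ^ (j : ℕ)) fun x => x j := by
    refine fun j => ⟨coord_mem_filt j, ?_⟩
    have : (fun x : Fin n → ZMod p => x j) ∘ w - (fun x => x j) = -disp w j := by
      ext x
      simp [disp]
    rw [this]
    exact Submodule.neg_mem _ (hw j)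
  have hpow : ∀ (j : Fin n) (m : ℕ), Q (m * p ^ (j : ℕ)) fun x => x j ^ m := by
    intro j m
    induction m with
    | zero =>
      have : (fun x : Fin n → ZMod p => x j ^ 0) = 1 := by ext; simp
      rw [zero_mul, this]
      exact hone
    | succ m ih =>
      rw [Nat.succ_mul]
      have := hmul ih (hcoord j)
      simp only [pow_succ]
      exact this
  have hprod : ∀ t : Finset (Fin n),
      Q (∑ j ∈ t, e j * p ^ (j : ℕ)) fun x => ∏ j ∈ t, x j ^ e j := by
    intro t
    induction t using Finset.induction_on with
    | empty =>
      have : (fun x : Fin n → ZMod p => ∏ j ∈ (∅ : Finset (Fin n)), x j ^ e j) = 1 := by ext; simp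
      rw [Finset.sum_empty, this]
      exact hone
    | insert i t hi ih =>
      rw [Finset.sum_insert hi]
      simp only [Finset.prod_insert hi]
      exact hmul (hpow i (e i)) ih
  exact (hprod Finset.univ).2

/-- A permutation whose displacements have degree at most `p ^ j - 1 - s` lowers the degree of
every function by at least `1 + s`. -/
theorem comp_sub_mem {w : Equiv.Perm (Fin n → ZMod p)} {s : ℕ}
    (hw : ∀ j : Fin n, disp w j ∈ filt p n (p ^ (j : ℕ) - s)) {g : (Fin n → ZMod p) → ZMod p} {d : ℕ}
    (hg : g ∈ filt p n d) : g ∘ w - g ∈ filt p n (d - 1 - s) := by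
  induction hg using Submodule.span_induction with
  | mem g hg =>
    obtain ⟨e, he, rfl⟩ := hg
    exact filt_le (by omega) (mono_comp_sub_mem hw e)
  | zero =>
    have : (0 : (Fin n → ZMod p) → ZMod p) ∘ w - 0 = 0 := by ext; simp
    rw [this]
    exact Submodule.zero_mem _
  | add g h _ _ hg hh =>
    have : (g + h) ∘ w - (g + h) = (g ∘ w - g) + (h ∘ w - h) := by
      ext
      simp
      ring
    rw [this]
    exact Submodule.add_mem _ hg hh
  | smul c g _ hg =>
    have : (c • g) ∘ w - c • g = c • (g ∘ w - g) := by
      ext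
      simp
      ring
    rw [this]
    exact Submodule.smul_mem _ c hg

theorem comp_mem {w : Equiv.Perm (Fin n → ZMod p)}
    (hw : ∀ j : Fin n, disp w j ∈ filt p n (p ^ (j : ℕ))) {g : (Fin n → ZMod p) → ZMod p} {d : ℕ}
    (hg : g ∈ filt p n d) : g ∘ w ∈ filt p n d := by
  have := (filt p n d).add_mem
    (filt_le (by omega : d - 1 - 0 ≤ d) (comp_sub_mem (s := 0) (by simpa using hw) hg)) hg
  simpa using this

/-! ### Functions of the first coordinates -/

theorem eq_zero_of_wt_lt {k : ℕ} {e : Fin n → ℕ} (hp : 0 < p) (h : wt p e < p ^ k) (j : Fin n)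
    (hj : k ≤ j) : e j = 0 := by
  by_contra h0
  have h1 : e j * p ^ (j : ℕ) ≤ wt p e :=
    Finset.single_le_sum (f := fun j : Fin n => e j * p ^ (j : ℕ)) (fun _ _ => Nat.zero_le _)
      (Finset.mem_univ j)
  have h2 : p ^ k ≤ p ^ (j : ℕ) := Nat.pow_le_pow_right hp hj
  have := Nat.le_mul_of_pos_left (p ^ (j : ℕ)) (Nat.pos_of_ne_zero h0)
  omega

theorem dependsOn_of_mem_filt {k d : ℕ} {g : (Fin n → ZMod p) → ZMod p} (hd : d ≤ p ^ k)
    (hp : 0 < p) (hg : g ∈ filt p n d) : DependsOn g {j : Fin n | (j : ℕ) < k} := by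
  intro x y hxy
  induction hg using Submodule.span_induction with
  | mem g hg =>
    obtain ⟨e, he, rfl⟩ := hg
    refine Finset.prod_congr rfl fun j _ => ?_
    by_cases hj : (j : ℕ) < k
    · rw [hxy j hj]
    · simp [eq_zero_of_wt_lt hp (he.trans_le hd) j (not_lt.mp hj)]
  | zero => rfl
  | add g h _ _ hg hh => simp [hg, hh]
  | smul c g _ hg => simp [hg]

theorem sum_top_digits [NeZero p] {k : ℕ} (hk : k ≤ n) :
    ∑ j ∈ Finset.univ.filter (fun j : Fin n => (j : ℕ) < k), (p - 1) * p ^ (j : ℕ) + 1 = p ^ k := by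
  have h1 : ∑ j ∈ Finset.univ.filter (fun j : Fin n => (j : ℕ) < k), (p - 1) * p ^ (j : ℕ)
      = ∑ j ∈ Finset.range k, (p - 1) * p ^ j := by
    rw [Finset.sum_filter, Fin.sum_univ_eq_sum_range
      (fun j => if j < k then (p - 1) * p ^ j else 0) n, ← Finset.sum_filter]
    congr 1
    ext j
    simp
    omega
  rw [h1, ← Finset.mul_sum]
  have hp : 0 < p := NeZero.pos p
  clear h1
  induction k with
  | zero => simp
  | succ k ih =>
    have := ih (by omega)
    rw [Finset.sum_range_succ, mul_add, add_right_comm, this, pow_succ']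
    obtain ⟨q, rfl⟩ : ∃ q, p = q + 1 := ⟨p - 1, by omega⟩
    simp
    ring

/-- Every function of the coordinates `x_j`, `j < k`, has degree `< p ^ k`, by interpolation. -/
theorem mem_filt_of_dependsOn [Fact p.Prime] {k : ℕ} (hk : k ≤ n)
    {g : (Fin n → ZMod p) → ZMod p} (hg : DependsOn g {j : Fin n | (j : ℕ) < k}) :
    g ∈ filt p n (p ^ k) := by
  classical
  -- `t` forgets the coordinates from `k` on; its fixed points are the interpolation points
  let t : (Fin n → ZMod p) → Fin n → ZMod p := fun x j => if (j : ℕ) < k then x j else 0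
  have key : g = ∑ a : Fin n → ZMod p with t a = a,
      g a • ∏ j ∈ Finset.univ.filter (fun j : Fin n => (j : ℕ) < k),
         (1 - ((fun x => x j) - fun _ => a j) ^ (p - 1)) := by
    ext x
    rw [Finset.sum_apply, Finset.sum_eq_single (t x)]
    · have h1 : g (t x) = g x := hg fun j hj => by simp [t, Set.mem_ofPred_eq.mp hj]
      rw [Pi.smul_apply, Finset.prod_apply, Finset.prod_eq_one, h1, smul_eq_mul, mul_one]
      intro j hj
      have hj' : (j : ℕ) < k := by simpa using hj
      have hp := (Fact.out : p.Prime).two_le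
      simp [t, hj', zero_pow (by omega : p - 1 ≠ 0)]
    · intro a ha hax
      have ha' : t a = a := by simpa using ha
      obtain ⟨j, hj, hj'⟩ : ∃ j : Fin n, (j : ℕ) < k ∧ x j - a j ≠ 0 := by
        by_contra! hcon
        apply hax
        rw [← ha']
        ext j
        by_cases hj : (j : ℕ) < k
        · simpa [t, hj] using (sub_eq_zero.mp (hcon j hj)).symm
        · simp [t, hj]
      rw [Pi.smul_apply, Finset.prod_apply, Finset.prod_eq_zero (i := j) (by simpa using hj),
        smul_zero]
      simp [ZMod.pow_card_sub_one_eq_one hj']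
    · intro h
      refine absurd (Finset.mem_filter.mpr ⟨Finset.mem_univ _, ?_⟩) h
      ext j
      by_cases hj : (j : ℕ) < k <;> simp [t, hj]
  rw [key]
  refine Submodule.sum_mem _ fun a _ => Submodule.smul_mem _ _ ?_
  rw [← sum_top_digits hk]
  refine prod_mem_filt _ _ _ fun j _ => ?_
  refine Submodule.sub_mem _ (one_mem_filt (by omega)) (pow_mem_filt ?_ _)
  exact Submodule.sub_mem _ (coord_mem_filt j) (const_mem_filt (by omega) _)

/-! ### Reduced monomials -/

theorem wt_val_eq (e : Fin n → Fin p) :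
    wt p (fun j => (e j : ℕ)) = (finFunctionFinEquiv e : ℕ) := by
  rw [finFunctionFinEquiv_apply, wt]

theorem exists_reduced_of_lt {d : ℕ} (hd : d < p ^ n) :
    ∃ e : Fin n → Fin p, wt p (fun j => (e j : ℕ)) = d :=
  ⟨finFunctionFinEquiv.symm ⟨d, hd⟩, by rw [wt_val_eq, Equiv.apply_symm_apply]⟩

theorem eq_of_wt_eq {e e' : Fin n → ℕ} (he : ∀ j, e j < p) (he' : ∀ j, e' j < p)
    (h : wt p e = wt p e') : e = e' := by
  have h1 : (fun j => (⟨e j, he j⟩ : Fin p)) = fun j => ⟨e' j, he' j⟩ := by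
    apply finFunctionFinEquiv.injective
    apply Fin.ext
    rw [← wt_val_eq, ← wt_val_eq]
    exact h
  ext j
  exact congrArg Fin.val (congrFun h1 j)

/-- Over `𝔽_p` every power function is a power function with exponent `< p`. -/
theorem exists_pow_eq [Fact p.Prime] (m : ℕ) :
    ∃ r < p, r ≤ m ∧ ∀ x : ZMod p, x ^ m = x ^ r := by
  induction m using Nat.strong_induction_on with
  | _ m ih =>
    have hp := (Fact.out : p.Prime).two_le
    rcases lt_or_ge m p with h | h
    · exact ⟨m, h, le_rfl, fun _ => rfl⟩
    · obtain ⟨r, hr, hrm, hx⟩ := ih (m - p + 1) (by omega)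
      refine ⟨r, hr, by omega, fun x => ?_⟩
      rw [← hx, show m = p + (m - p) by omega, pow_add, ZMod.pow_card, pow_succ',
        Nat.add_sub_cancel_left]

theorem exists_reduced_mono_eq [Fact p.Prime] (e : Fin n → ℕ) :
    ∃ e' : Fin n → Fin p, wt p (fun j => (e' j : ℕ)) ≤ wt p e ∧
      mono p (fun j => (e' j : ℕ)) = mono p e := by
  choose r hr hrm hx using fun j => exists_pow_eq (p := p) (e j)
  refine ⟨fun j => ⟨r j, hr j⟩, ?_, ?_⟩
  · exact Finset.sum_le_sum fun j _ => Nat.mul_le_mul_right _ (hrm j)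
  · ext x
    exact Finset.prod_congr rfl fun j _ => (hx j _).symm

theorem filt_eq_span_reduced [Fact p.Prime] (d : ℕ) :
    filt p n d = Submodule.span (ZMod p)
      ((fun e : Fin n → Fin p => mono p fun j => (e j : ℕ)) ''
        {e | wt p (fun j => (e j : ℕ)) < d}) := by
  apply le_antisymm
  · refine Submodule.span_le.mpr ?_
    rintro _ ⟨e, he, rfl⟩
    obtain ⟨e', hw, hm⟩ := exists_reduced_mono_eq (p := p) e
    exact Submodule.subset_span ⟨e', hw.trans_lt he, hm⟩
  · refine Submodule.span_le.mpr ?_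
    rintro _ ⟨e, he, rfl⟩
    exact mono_mem_filt he

theorem filt_top [Fact p.Prime] : filt p n (p ^ n) = ⊤ :=
  eq_top_iff.mpr fun _ _ => mem_filt_of_dependsOn le_rfl fun _ _ h =>
    congrArg _ (funext fun j => h j j.isLt)

theorem linearIndependent_mono [Fact p.Prime] :
    LinearIndependent (ZMod p) fun e : Fin n → Fin p => mono p fun j => (e j : ℕ) := by
  apply linearIndependent_of_top_le_span_of_card_eq_finrank
  · rw [← filt_top, filt_eq_span_reduced]
    exact Submodule.span_mono (Set.image_subset_range _ _)
  · simp [ZMod.card]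

theorem mono_notMem_filt [Fact p.Prime] {e : Fin n → ℕ} (he : ∀ j, e j < p) :
    mono p e ∉ filt p n (wt p e) := by
  rw [filt_eq_span_reduced]
  exact (linearIndependent_mono (p := p) (n := n)).notMem_span_image
    (x := fun j => ⟨e j, he j⟩) (by simp)

/-- The functions of degree at most `d` are spanned, modulo those of degree `< d`, by the reduced
monomial of degree `d`: this is the uniqueness of expansions in base `p`. -/
theorem exists_sub_smul_mem_filt [Fact p.Prime] {e : Fin n → ℕ} (he : ∀ j, e j < p)
    {g : (Fin n → ZMod p) → ZMod p} (hg : g ∈ filt p n (wt p e + 1)) :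
    ∃ c : ZMod p, g - c • mono p e ∈ filt p n (wt p e) := by
  rw [filt_eq_span_reduced] at hg
  induction hg using Submodule.span_induction with
  | mem g hg =>
    obtain ⟨e', he', rfl⟩ := hg
    rcases Nat.lt_succ_iff_lt_or_eq.mp he' with h | h
    · exact ⟨0, by simpa using mono_mem_filt h⟩
    · refine ⟨1, ?_⟩
      have := eq_of_wt_eq (fun j => (e' j).isLt) he h
      simp [this]
  | zero => exact ⟨0, by simp⟩
  | add g h _ _ hg hh =>
    obtain ⟨a, ha⟩ := hg
    obtain ⟨b, hb⟩ := hh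
    refine ⟨a + b, ?_⟩
    convert Submodule.add_mem _ ha hb using 1
    module
  | smul c g _ hg =>
    obtain ⟨a, ha⟩ := hg
    refine ⟨c * a, ?_⟩
    convert Submodule.smul_mem _ c ha using 1
    module

/-! ### Leading terms -/

theorem pow_sub_mem_filt {a b : ℕ} (hab : a < b) {f X : (Fin n → ZMod p) → ZMod p}
    (hf : f ∈ filt p n (a + 1)) (hX : X ∈ filt p n (b + 1)) (m : ℕ) :
    (X - f) ^ (m + 1) - X ^ (m + 1) + ((m + 1 : ℕ) : ZMod p) • (f * X ^ m) ∈
      filt p n (m * b + a) := by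
  induction m with
  | zero =>
    convert Submodule.zero_mem _ using 1
    simp
  | succ m ih =>
    have h1 := mul_mem_filt ih
      (Submodule.sub_mem _ hX (filt_le (by omega : a + 1 ≤ b + 1) hf))
    have h2 := mul_mem_filt (mul_mem_filt hf hf) (pow_mem_filt hX m)
    have h3 := Submodule.add_mem _ (filt_le (by rw [Nat.succ_mul]; omega) h1)
      (Submodule.smul_mem _ ((m + 1 : ℕ) : ZMod p)
        (filt_le (by rw [Nat.succ_mul]; omega : a + 1 + a + m * b ≤ (m + 1) * b + a) h2))
    convert h3 using 1
    ext x
    simp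
    ring

/-- The leading term of `x ^ e ∘ v - x ^ e`, when `v` subtracts from the coordinate `x_j` a
function `f` of degree at most `a < p ^ j`: it is that of `-f ∂_j x ^ e`. -/
theorem mono_comp_shift {v : Equiv.Perm (Fin n → ZMod p)} {j : Fin n} {a : ℕ}
    (ha : a < p ^ (j : ℕ)) (hv : disp v j ∈ filt p n (a + 1)) (hv' : ∀ i ≠ j, disp v i = 0)
    {e : Fin n → ℕ} (he : e j = 0) (m : ℕ) :
    mono p (Pi.single j (m + 1) + e) ∘ v - mono p (Pi.single j (m + 1) + e) +
      ((m + 1 : ℕ) : ZMod p) • (disp v j * mono p (Pi.single j m + e)) ∈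
      filt p n (m * p ^ (j : ℕ) + wt p e + a) := by
  have hr : mono p e ∘ v = mono p e := by
    ext x
    change ∏ i, v x i ^ e i = ∏ i, x i ^ e i
    refine Finset.prod_congr rfl fun i _ => ?_
    by_cases hi : i = j
    · subst hi
      simp [he]
    · have := congrFun (hv' i hi) x
      rw [disp, Pi.zero_apply, sub_eq_zero] at this
      rw [← this]
  have h := mul_mem_filt (pow_sub_mem_filt ha hv (coord_mem_filt j) m)
    (mono_mem_filt (Nat.lt_succ_self (wt p e)))
  rw [add_right_comm]
  convert h using 1
  have hr' := fun x => congrFun hr x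
  simp only [Function.comp_apply] at hr'
  rw [← mono_mul_mono, ← mono_mul_mono, mono_single, mono_single]
  ext x
  simp only [Pi.add_apply, Pi.sub_apply, Pi.mul_apply, Pi.smul_apply, Pi.pow_apply,
    Function.comp_apply, hr', disp, smul_eq_mul]
  ring

/-- The exponents of `x_0 ^ (p - 1) ⋯ x_{k-1} ^ (p - 1)`, the reduced monomial of largest degree
in the coordinates before `k`. -/
def topExp (p : ℕ) {n : ℕ} (k : ℕ) : Fin n → ℕ := fun i => if (i : ℕ) < k then p - 1 else 0

theorem topExp_lt [NeZero p] (k : ℕ) (i : Fin n) : topExp p k i < p := by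
  have := NeZero.pos p
  unfold topExp
  split_ifs <;> omega

theorem wt_topExp [NeZero p] {k : ℕ} (hk : k ≤ n) :
    wt p (topExp p k : Fin n → ℕ) + 1 = p ^ k := by
  rw [← sum_top_digits hk, wt, Finset.sum_filter]
  simp [topExp]

theorem exists_lowest_digit {e : Fin n → ℕ} {d : ℕ} (hd : wt p e = d + 1) :
    ∃ (j : Fin n) (m : ℕ) (e₀ : Fin n → ℕ), (∀ i ≤ j, e₀ i = 0) ∧
      e = Pi.single j (m + 1) + e₀ := by
  have hne : (Finset.univ.filter fun j : Fin n => e j ≠ 0).Nonempty := by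
    by_contra h
    rw [Finset.not_nonempty_iff_eq_empty, Finset.filter_eq_empty_iff] at h
    have : wt p e = 0 := Finset.sum_eq_zero fun j hj => by
      rw [not_not.mp (h hj), zero_mul]
    omega
  obtain ⟨j, hj, hmin⟩ := Finset.exists_min_image _ id hne
  rw [Finset.mem_filter] at hj
  refine ⟨j, e j - 1, Function.update e j 0, fun i hi => ?_, ?_⟩
  · rcases hi.eq_or_lt with rfl | hi'
    · simp
    · rw [Function.update_of_ne hi'.ne]
      by_contra h0
      exact absurd (hmin i (by simpa using h0)) (not_le.mpr hi')
  · ext i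
    by_cases hi : i = j
    · subst hi
      have := hj.2
      simp
      omega
    · simp [hi]

/-- The permutation that subtracts `x_0 ^ (p - 1) ⋯ x_{j-1} ^ (p - 1)` from `x_j`, for `j` the
lowest nonzero digit of `d + 1` in base `p`, takes the monomial of degree `d + 1` to itself plus
a nonzero multiple of the monomial of degree `d`, up to terms of degree `< d`. -/
theorem exists_leading_term [Fact p.Prime] {d : ℕ} (hd : d + 1 < p ^ n) :
    ∃ (j : Fin n) (e e' : Fin n → ℕ) (c : ZMod p), p ^ (j : ℕ) ≤ d + 1 ∧
      (∀ i, e i < p) ∧ (∀ i, e' i < p) ∧ wt p e = d + 1 ∧ wt p e' = d ∧ c ≠ 0 ∧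
      ∀ v : Equiv.Perm (Fin n → ZMod p), disp v j = mono p (topExp p (j : ℕ)) →
        (∀ i ≠ j, disp v i = 0) → mono p e ∘ v - mono p e - c • mono p e' ∈ filt p n d := by
  obtain ⟨e₁, he₁⟩ := exists_reduced_of_lt hd
  obtain ⟨j, m, e₀, h0, he⟩ := exists_lowest_digit he₁
  have hlt : ∀ i, (Pi.single j (m + 1) + e₀ : Fin n → ℕ) i < p := fun i => by
    rw [← he]
    exact (e₁ i).isLt
  rw [he] at he₁
  have hwt := he₁
  rw [wt_add, wt_single, Nat.succ_mul] at hwt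
  have htop := wt_topExp (p := p) (n := n) j.isLt.le
  have hm : m + 1 < p := by simpa [h0 j le_rfl] using hlt j
  have hwt' : wt p (topExp p (j : ℕ) + (Pi.single j m + e₀)) = d := by
    rw [wt_add, wt_add, wt_single]
    omega
  refine ⟨j, _, topExp p j + (Pi.single j m + e₀), -((m + 1 : ℕ) : ZMod p), by omega, hlt,
    fun i => ?_, he₁, hwt', ?_, fun v hv hv' => ?_⟩
  · rcases lt_trichotomy i j with hi | rfl | hi
    · simpa [hi.ne, h0 i hi.le] using topExp_lt (p := p) (j : ℕ) i
    · simp [topExp, h0 i le_rfl]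
      omega
    · have := hlt i
      have h2 : ¬ (i : ℕ) < j := not_lt.mpr hi.le
      simpa [topExp, hi.ne', h2] using this
  · rw [neg_ne_zero, Ne, ZMod.natCast_eq_zero_iff]
    exact Nat.not_dvd_of_pos_of_lt (Nat.succ_pos m) hm
  · have h := mono_comp_shift (a := wt p (topExp p (j : ℕ) : Fin n → ℕ)) (by omega)
      (by rw [hv]; exact mono_mem_filt (Nat.lt_succ_self _)) hv' (h0 j le_rfl) m
    rw [hv, mono_mul_mono] at h
    rw [neg_smul, sub_neg_eq_add]
    exact filt_le (by omega) h

/-- A function `g` of degree at most `d + 1` has degree at most `d` if `g ∘ v - g` has degree `< d`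
for the permutation `v` of `exists_leading_term`. -/
theorem exists_mem_filt_of_comp_sub_mem [Fact p.Prime] {d : ℕ} (hd : d + 1 < p ^ n) :
    ∃ j : Fin n, p ^ (j : ℕ) ≤ d + 1 ∧
      ∀ v : Equiv.Perm (Fin n → ZMod p), disp v j = mono p (topExp p (j : ℕ)) →
        (∀ i ≠ j, disp v i = 0) → (∀ i : Fin n, disp v i ∈ filt p n (p ^ (i : ℕ))) →
        ∀ g ∈ filt p n (d + 2), g ∘ v - g ∈ filt p n d → g ∈ filt p n (d + 1) := by
  obtain ⟨j, e, e', c, hj, he, he', hwt, hwt', hc, H⟩ := exists_leading_term hd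
  refine ⟨j, hj, fun v hv hv' hvW g hg hgv => ?_⟩
  obtain ⟨a, ha⟩ := exists_sub_smul_mem_filt he (by rwa [hwt])
  rw [hwt] at ha
  have h1 := comp_sub_mem (s := 0) (by simpa using hvW) ha
  rw [Nat.add_sub_cancel, Nat.sub_zero] at h1
  have h2 : a • c • mono p e' ∈ filt p n d := by
    have h3 := Submodule.sub_mem _ (Submodule.sub_mem _ hgv h1)
      (Submodule.smul_mem _ a (H v hv hv'))
    convert h3 using 1
    ext x
    simp
    ring
  have ha0 : a = 0 := by
    by_contra ha0
    rw [smul_smul] at h2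
    have h4 := Submodule.smul_mem _ (a * c)⁻¹ h2
    rw [inv_smul_smul₀ (mul_ne_zero ha0 hc)] at h4
    exact mono_notMem_filt he' (hwt'.symm ▸ h4)
  simpa [ha0] using ha

/-- Every function of degree at most `d` is, up to functions of degree `< d`, a multiple of the
difference of a function of degree `d + 1` under the permutation of `exists_leading_term`. -/
theorem exists_comp_sub_sub_mem [Fact p.Prime] {d : ℕ} (hd : d + 1 < p ^ n) :
    ∃ (j : Fin n) (h : (Fin n → ZMod p) → ZMod p), p ^ (j : ℕ) ≤ d + 1 ∧ h ∈ filt p n (d + 2) ∧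
      ∀ v : Equiv.Perm (Fin n → ZMod p), disp v j = mono p (topExp p (j : ℕ)) →
        (∀ i ≠ j, disp v i = 0) → ∀ g ∈ filt p n (d + 1),
          ∃ c : ZMod p, g - c • (h ∘ v - h) ∈ filt p n d := by
  obtain ⟨j, e, e', c, hj, he, he', hwt, hwt', hc, H⟩ := exists_leading_term hd
  refine ⟨j, mono p e, hj, mono_mem_filt (by omega), fun v hv hv' g hg => ?_⟩
  obtain ⟨a, ha⟩ := exists_sub_smul_mem_filt he' (by rwa [hwt'])
  rw [hwt'] at ha
  refine ⟨a * c⁻¹, ?_⟩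
  have h3 := Submodule.sub_mem _ ha (Submodule.smul_mem _ (a * c⁻¹) (H v hv hv'))
  convert h3 using 1
  ext x
  simp
  field_simp
  ring

/-- A translation of `x_k` by a nonzero constant lowers the degree of
`x_0 ^ (p - 1) ⋯ x_{l-1} ^ (p - 1)`, where `k < l`, by `p ^ k` and not by more. -/
theorem eq_zero_of_mono_comp_sub_mem [Fact p.Prime] {k l : Fin n} (hkl : k < l) {c : ZMod p}
    {v : Equiv.Perm (Fin n → ZMod p)} (hv : disp v k = fun _ => c) (hv' : ∀ i ≠ k, disp v i = 0)
    (h : mono p (topExp p (l : ℕ)) ∘ v - mono p (topExp p (l : ℕ)) ∈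
      filt p n (p ^ (l : ℕ) - 1 - p ^ (k : ℕ))) : c = 0 := by
  have hp := (Fact.out : p.Prime).two_le
  have hpk : 0 < p ^ (k : ℕ) := Nat.pow_pos (by omega)
  set e₀ : Fin n → ℕ := Function.update (topExp p (l : ℕ)) k 0 with he₀
  have he : (topExp p (l : ℕ) : Fin n → ℕ) = Pi.single k (p - 2 + 1) + e₀ := by
    ext i
    by_cases hi : i = k
    · subst hi
      have : (i : ℕ) < l := hkl
      simp [he₀, topExp, this]
      omega
    · simp [he₀, hi]
  have hwt := wt_topExp (p := p) (n := n) l.isLt.le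
  rw [he, wt_add, wt_single, Nat.succ_mul] at hwt
  have hs := mono_comp_shift (a := 0) hpk (by rw [hv]; exact const_mem_filt (by omega) c) hv'
    (e := e₀) (by simp [he₀]) (p - 2)
  rw [← he, hv] at hs
  have hwt' : wt p (Pi.single k (p - 2) + e₀) = p ^ (l : ℕ) - 1 - p ^ (k : ℕ) := by
    rw [wt_add, wt_single]
    omega
  have h1 := Submodule.sub_mem _ hs
    (filt_le (by omega : _ ≤ (p - 2) * p ^ (k : ℕ) + wt p e₀ + 0) h)
  rw [add_sub_cancel_left, add_zero] at h1
  rw [wt_add, wt_single] at hwt'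
  have hred : ∀ i, (Pi.single k (p - 2) + e₀ : Fin n → ℕ) i < p := fun i => by
    by_cases hi : i = k
    · subst hi
      simp [he₀]
      omega
    · simpa [he₀, hi] using topExp_lt (p := p) (l : ℕ) i
  by_contra hc
  have hm : ((p - 2 + 1 : ℕ) : ZMod p) ≠ 0 := by
    rw [Ne, ZMod.natCast_eq_zero_iff]
    exact Nat.not_dvd_of_pos_of_lt (Nat.succ_pos _) (by omega)
  have h2 := Submodule.smul_mem _ (((p - 2 + 1 : ℕ) : ZMod p) * c)⁻¹ h1
  have h3 : (fun _ => c) * mono p (Pi.single k (p - 2) + e₀) =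
      c • mono p (Pi.single k (p - 2) + e₀) := by
    ext x
    simp
  rw [h3, smul_smul _ c, inv_smul_smul₀ (mul_ne_zero hm hc)] at h2
  refine mono_notMem_filt hred ?_
  rwa [wt_add, wt_single]

/-! ### Displacements and shears -/

theorem disp_one (k : Fin n) : disp (1 : Equiv.Perm (Fin n → ZMod p)) k = 0 := by
  ext x
  simp [disp]

theorem disp_mul (w v : Equiv.Perm (Fin n → ZMod p)) (k : Fin n) :
    disp (w * v) k = disp v k + disp w k ∘ v := by
  ext x
  simp [disp]

theorem ext_disp {w v : Equiv.Perm (Fin n → ZMod p)} (h : ∀ k, disp w k = disp v k) : w = v := by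
  ext x k
  have := congrFun (h k) x
  simpa [disp] using this

theorem disp_delta_self (k : Fin n) (f : Multiplicative ((Fin k → ZMod p) → ZMod p)) :
    disp (delta p k f) k = fun x => f.toAdd fun j : Fin k => x (Fin.castLE k.isLt.le j) := by
  ext x
  simp [disp, delta]

theorem disp_delta_of_ne {k i : Fin n} (h : i ≠ k)
    (f : Multiplicative ((Fin k → ZMod p) → ZMod p)) : disp (delta p k f) i = 0 := by
  ext x
  simp [disp, delta, h]

/-- The permutation `g Δ_k` for a function `g` of all coordinates, in which those from `k` on are
set to zero. -/
def shear (p : ℕ) {n : ℕ} (k : Fin n) (g : (Fin n → ZMod p) → ZMod p) :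
    Equiv.Perm (Fin n → ZMod p) :=
  delta p k (Multiplicative.ofAdd fun y => g fun i => if h : (i : ℕ) < k then y ⟨i, h⟩ else 0)

theorem shear_add (k : Fin n) (g h : (Fin n → ZMod p) → ZMod p) :
    shear p k (g + h) = shear p k g * shear p k h := by
  rw [shear, shear, shear, ← map_mul]
  rfl

theorem shear_zero (k : Fin n) : shear p k 0 = 1 :=
  map_one (delta p k)

theorem shear_neg (k : Fin n) (g : (Fin n → ZMod p) → ZMod p) :
    shear p k (-g) = (shear p k g)⁻¹ := by
  rw [shear, shear, ← map_inv]
  rfl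

theorem disp_shear_self [NeZero p] {k : Fin n} {g : (Fin n → ZMod p) → ZMod p} {d : ℕ}
    (hd : d ≤ p ^ (k : ℕ)) (hg : g ∈ filt p n d) : disp (shear p k g) k = g := by
  rw [shear, disp_delta_self]
  ext x
  refine dependsOn_of_mem_filt hd (NeZero.pos p) hg fun j hj => ?_
  have hj' : (j : ℕ) < k := hj
  simp [hj']

theorem disp_shear_of_ne {k i : Fin n} (h : i ≠ k) (g : (Fin n → ZMod p) → ZMod p) :
    disp (shear p k g) i = 0 :=
  disp_delta_of_ne h _

theorem disp_delta_mem_filt [Fact p.Prime] (k i : Fin n)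
    (f : Multiplicative ((Fin k → ZMod p) → ZMod p)) :
    disp (delta p k f) i ∈ filt p n (p ^ (i : ℕ)) := by
  by_cases h : i = k
  · subst h
    rw [disp_delta_self]
    refine mem_filt_of_dependsOn i.isLt.le fun x y hxy => ?_
    exact congrArg _ (funext fun j => hxy _ j.isLt)
  · rw [disp_delta_of_ne h]
    exact Submodule.zero_mem _

theorem delta_eq_shear [Fact p.Prime] (k : Fin n)
    (f : Multiplicative ((Fin k → ZMod p) → ZMod p)) :
    delta p k f = shear p k (disp (delta p k f) k) := by
  refine ext_disp fun i => ?_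
  by_cases h : i = k
  · subst h
    rw [disp_shear_self le_rfl (disp_delta_mem_filt _ _ _)]
  · rw [disp_delta_of_ne h, disp_shear_of_ne h]

theorem comp_eq_self {k : Fin n} {d : ℕ} (hd : d ≤ p ^ (k : ℕ)) (hp : 0 < p)
    {g : (Fin n → ZMod p) → ZMod p} (hg : g ∈ filt p n d) {z : Equiv.Perm (Fin n → ZMod p)}
    (hz : ∀ i < k, disp z i = 0) : g ∘ z = g := by
  ext x
  refine dependsOn_of_mem_filt hd hp hg fun i hi => ?_
  have := congrFun (hz i hi) x
  exact (sub_eq_zero.mp this).symm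

/-! ### The weight filtration of the wreath product -/

/-- The permutations whose displacement of `x_k` has degree less than `p ^ k - s`, for every
`k`, as a submonoid; `weightSubgroup` is the same set as a subgroup. -/
def weightSubmonoid (p n s : ℕ) : Submonoid (Equiv.Perm (Fin n → ZMod p)) where
  carrier := {w | ∀ k : Fin n, disp w k ∈ filt p n (p ^ (k : ℕ) - s)}
  one_mem' k := by
    rw [disp_one]
    exact Submodule.zero_mem _
  mul_mem' {w v} hw hv k := by
    rw [disp_mul]
    exact Submodule.add_mem _ (hv k) (comp_mem (fun j => filt_le (Nat.sub_le _ _) (hv j)) (hw k))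

/-- The permutations of weight greater than `s`, the weight of `x ^ e Δ_k` being `p ^ k - wt e`
(that is, `p ^ (n - 1)` minus the `p`-degree). These subgroups turn out to be the terms of both
central series of the wreath product. -/
def weightSubgroup (p n s : ℕ) [NeZero p] : Subgroup (Equiv.Perm (Fin n → ZMod p)) where
  toSubmonoid := weightSubmonoid p n s
  inv_mem' {w} hw := by
    -- in a finite group the inverse is a power
    have h : w⁻¹ ∈ Submonoid.powers w :=
      mem_powers_iff_mem_zpowers.mpr (Subgroup.inv_mem _ (Subgroup.mem_zpowers w))
    exact (Submonoid.powers_le (P := weightSubmonoid p n s)).mpr hw h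

theorem mem_weightSubgroup [NeZero p] {s : ℕ} {w : Equiv.Perm (Fin n → ZMod p)} :
    w ∈ weightSubgroup p n s ↔ ∀ k : Fin n, disp w k ∈ filt p n (p ^ (k : ℕ) - s) :=
  Iff.rfl

theorem weightSubgroup_antitone [NeZero p] {s t : ℕ} (h : s ≤ t) :
    weightSubgroup p n t ≤ weightSubgroup p n s :=
  fun _ hw k => filt_le (Nat.sub_le_sub_left h _) (hw k)

theorem weightSubgroup_eq_bot [NeZero p] {s : ℕ} (h : p ^ (n - 1) ≤ s) :
    weightSubgroup p n s = ⊥ := by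
  refine (Subgroup.eq_bot_iff_forall _).mpr fun w hw => ext_disp fun k => ?_
  have h1 := hw k
  have h2 : p ^ (k : ℕ) ≤ p ^ (n - 1) := Nat.pow_le_pow_right (NeZero.pos p) (by omega)
  rw [Nat.sub_eq_zero_of_le (h2.trans h), filt_zero, Submodule.mem_bot] at h1
  rw [h1, disp_one]

theorem shear_mem_weightSubgroup [NeZero p] {s : ℕ} {k : Fin n} {g : (Fin n → ZMod p) → ZMod p}
    (hg : g ∈ filt p n (p ^ (k : ℕ) - s)) : shear p k g ∈ weightSubgroup p n s := by
  intro i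
  by_cases h : i = k
  · subst h
    rwa [disp_shear_self (Nat.sub_le _ _) hg]
  · rw [disp_shear_of_ne h]
    exact Submodule.zero_mem _

/-- The weight filtration is generated by the shears that it contains: the displacements of an
element are removed one by one by multiplying with shears. -/
theorem weightSubgroup_le [NeZero p] {s : ℕ} {K : Subgroup (Equiv.Perm (Fin n → ZMod p))}
    (hK : ∀ (k : Fin n), ∀ g ∈ filt p n (p ^ (k : ℕ) - s), shear p k g ∈ K) :
    weightSubgroup p n s ≤ K := by
  have key : ∀ (S : Finset (Fin n)), ∀ w ∈ weightSubgroup p n s, (∀ k ∉ S, disp w k = 0) →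
      w ∈ K := by
    intro S
    induction S using Finset.induction_on with
    | empty =>
      intro w _ h
      have : w = 1 := ext_disp fun k => by rw [h k (Finset.notMem_empty k), disp_one]
      exact this ▸ K.one_mem
    | insert m S hm ih =>
      intro w hw h
      have hv := Submodule.neg_mem _ (hw m)
      have h1 : w * shear p m (-disp w m) ∈ K := by
        refine ih _ (mul_mem hw (shear_mem_weightSubgroup hv)) fun k hk => ?_
        rw [disp_mul]
        by_cases hkm : k = m
        · subst hkm
          rw [disp_shear_self (Nat.sub_le _ _) hv, comp_eq_self (Nat.sub_le _ _) (NeZero.pos p)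
            (hw k) fun i hi => disp_shear_of_ne hi.ne _, neg_add_cancel]
        · rw [disp_shear_of_ne hkm, h k (by simp [hkm, hk]), zero_add]
          rfl
      exact (K.mul_mem_cancel_right (hK m _ hv)).mp h1
  exact fun w hw => key Finset.univ w hw fun k hk => absurd (Finset.mem_univ k) hk

theorem shear_mem_of_mono_mem [Fact p.Prime] {k : Fin n} {d : ℕ}
    {K : Subgroup (Equiv.Perm (Fin n → ZMod p))}
    (hK : ∀ e : Fin n → Fin p, wt p (fun j => (e j : ℕ)) < d →
      shear p k (mono p fun j => (e j : ℕ)) ∈ K)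
    {g : (Fin n → ZMod p) → ZMod p} (hg : g ∈ filt p n d) : shear p k g ∈ K := by
  let A : AddSubgroup ((Fin n → ZMod p) → ZMod p) :=
    { carrier := {g | shear p k g ∈ K}
      zero_mem' := by
        change shear p k 0 ∈ K
        rw [shear_zero]
        exact K.one_mem
      add_mem' := fun {g h} hg hh => by
        change shear p k (g + h) ∈ K
        rw [shear_add]
        exact K.mul_mem hg hh
      neg_mem' := fun {g} hg => by
        change shear p k (-g) ∈ K
        rw [shear_neg]
        exact K.inv_mem hg }
  have h : filt p n d ≤ AddSubgroup.toZModSubmodule p A := by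
    rw [filt_eq_span_reduced]
    refine Submodule.span_le.mpr ?_
    rintro _ ⟨e, he, rfl⟩
    exact hK e he
  exact h hg

theorem baseSubgroup_le [Fact p.Prime] (k : Fin n) : baseSubgroup p k ≤ weightSubgroup p n 0 := by
  rintro _ ⟨f, rfl⟩ i
  exact disp_delta_mem_filt k i f

theorem W_eq_weightSubgroup [Fact p.Prime] : W p n = weightSubgroup p n 0 :=
  le_antisymm (iSup_le baseSubgroup_le)
    (weightSubgroup_le fun k _ _ => Subgroup.mem_iSup_of_mem k ⟨_, rfl⟩)

/-! ### Generation by monomial elements -/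

theorem sum_castLE {M : Type*} [AddCommMonoid M] {k : Fin n} (f : Fin n → M)
    (hf : ∀ j, k ≤ j → f j = 0) : ∑ j : Fin k, f (Fin.castLE k.isLt.le j) = ∑ j, f j := by
  refine Finset.sum_bij_ne_zero (fun j _ _ => Fin.castLE k.isLt.le j) (by simp)
    (fun a _ _ b _ _ h => Fin.castLE_injective _ h) (fun b _ hb => ?_) (by simp)
  have hbk : (b : ℕ) < k := by
    by_contra h
    exact hb (hf b (not_lt.mp h))
  exact ⟨⟨b, hbk⟩, Finset.mem_univ _, hb, rfl⟩

theorem prod_castLE {M : Type*} [CommMonoid M] {k : Fin n} (f : Fin n → M)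
    (hf : ∀ j, k ≤ j → f j = 1) : ∏ j : Fin k, f (Fin.castLE k.isLt.le j) = ∏ j, f j :=
  sum_castLE (M := Additive M) f hf

/-- For exponents that vanish from `k` on, `x ^ e Δ_k` is the monomial element of the restricted
exponents. -/
theorem monomialElt_restrict [NeZero p] {k : Fin n} {e : Fin n → Fin p}
    (he : ∀ j, k ≤ j → (e j : ℕ) = 0) :
    monomialElt p k (fun j => e (Fin.castLE k.isLt.le j)) =
      shear p k (mono p fun j => (e j : ℕ)) := by
  unfold monomialElt shear
  congr 2
  ext y
  rw [mono, ← prod_castLE (k := k)]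
  · simp
  · intro j hj
    simp [he j hj]

theorem pdeg_restrict {k : Fin n} {e : Fin n → Fin p} (he : ∀ j, k ≤ j → (e j : ℕ) = 0) :
    pdeg p k (fun j => e (Fin.castLE k.isLt.le j)) =
      wt p (fun j => (e j : ℕ)) + (p ^ (n - 1) - p ^ (k : ℕ)) := by
  rw [pdeg, wt, ← sum_castLE (k := k) fun j : Fin n => (e j : ℕ) * p ^ (j : ℕ)]
  · simp
  · intro j hj
    simp [he j hj]

theorem exists_extend [NeZero p] {k : Fin n} (Λ : Fin k → Fin p) :
    ∃ e : Fin n → Fin p, (∀ j, k ≤ j → (e j : ℕ) = 0) ∧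
      (fun j => e (Fin.castLE k.isLt.le j)) = Λ := by
  refine ⟨fun i => if h : (i : ℕ) < k then Λ ⟨i, h⟩ else 0, fun j hj => ?_, ?_⟩
  · have : ¬ (j : ℕ) < k := not_lt.mpr hj
    simp [this]
  · ext j
    simp

theorem monomialElt_mem_weightSubgroup [NeZero p] {k : Fin n} {Λ : Fin k → Fin p} {i : ℕ}
    (hi : i ≤ p ^ (n - 1)) (h : pdeg p k Λ < i) :
    monomialElt p k Λ ∈ weightSubgroup p n (p ^ (n - 1) - i) := by
  obtain ⟨e, he, rfl⟩ := exists_extend Λ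
  rw [pdeg_restrict he] at h
  have h2 : p ^ (k : ℕ) ≤ p ^ (n - 1) := Nat.pow_le_pow_right (NeZero.pos p) (by omega)
  rw [monomialElt_restrict he]
  exact shear_mem_weightSubgroup (mono_mem_filt (by omega))

theorem shear_mem_closure_monomialElt [Fact p.Prime] {k : Fin n} {i : ℕ} (hi : i ≤ p ^ (n - 1))
    {g : (Fin n → ZMod p) → ZMod p} (hg : g ∈ filt p n (p ^ (k : ℕ) - (p ^ (n - 1) - i))) :
    shear p k g ∈ Subgroup.closure
      {w | ∃ Λ : Fin k → Fin p, pdeg p k Λ < i ∧ w = monomialElt p k Λ} := by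
  refine shear_mem_of_mono_mem (fun e he => ?_) hg
  have h0 := eq_zero_of_wt_lt (k := k) (NeZero.pos p) (he.trans_le (Nat.sub_le _ _))
  have h2 : p ^ (k : ℕ) ≤ p ^ (n - 1) := Nat.pow_le_pow_right (NeZero.pos p) (by omega)
  refine Subgroup.subset_closure ⟨_, ?_, (monomialElt_restrict h0).symm⟩
  rw [pdeg_restrict h0]
  omega

theorem weightSubgroup_eq_closure [Fact p.Prime] {i : ℕ} (hi : i ≤ p ^ (n - 1)) :
    weightSubgroup p n (p ^ (n - 1) - i) = Subgroup.closure {w | ∃ (k : Fin n) (Λ : Fin k → Fin p),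
      pdeg p k Λ < i ∧ w = monomialElt p k Λ} := by
  apply le_antisymm
  · refine weightSubgroup_le fun k g hg => ?_
    refine Subgroup.closure_mono ?_ (shear_mem_closure_monomialElt hi hg)
    exact fun w hw => ⟨k, hw⟩
  · refine (Subgroup.closure_le _).mpr ?_
    rintro _ ⟨k, Λ, h, rfl⟩
    exact monomialElt_mem_weightSubgroup hi h

theorem weightSubgroup_inf_baseSubgroup [Fact p.Prime] {i : ℕ} (hi : i ≤ p ^ (n - 1))
    (k : Fin n) :
    weightSubgroup p n (p ^ (n - 1) - i) ⊓ baseSubgroup p k =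
      Subgroup.closure {w | ∃ Λ : Fin k → Fin p, pdeg p k Λ < i ∧ w = monomialElt p k Λ} := by
  apply le_antisymm
  · rintro _ ⟨hw, f, rfl⟩
    rw [delta_eq_shear]
    exact shear_mem_closure_monomialElt hi (hw k)
  · refine (Subgroup.closure_le _).mpr ?_
    rintro _ ⟨Λ, h, rfl⟩
    exact ⟨monomialElt_mem_weightSubgroup hi h, _, rfl⟩

/-! ### Commutators -/

/-- Modulo a term of the weight filtration, the commutator of `w` and `v` is given by the
displacements of `w` and `v` as in the Lie bracket of vector fields. -/
theorem commutator_mem_weightSubgroup_iff [NeZero p] {s : ℕ} {w v : Equiv.Perm (Fin n → ZMod p)}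
    (hw : w ∈ weightSubgroup p n 0) (hv : v ∈ weightSubgroup p n 0) :
    ⁅w, v⁆ ∈ weightSubgroup p n s ↔ ∀ k : Fin n,
      (disp w k ∘ v - disp w k) - (disp v k ∘ w - disp v k) ∈ filt p n (p ^ (k : ℕ) - s) := by
  rw [mem_weightSubgroup]
  refine forall_congr' fun k => ?_
  have h : (disp w k ∘ v - disp w k) - (disp v k ∘ w - disp v k) =
      disp ⁅w, v⁆ k ∘ (v * w : Equiv.Perm (Fin n → ZMod p)) := by
    have h1 : ⁅w, v⁆ * (v * w) = w * v := by
      rw [commutatorElement_def]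
      group
    have h2 := congrArg (fun z => disp z k) h1
    simp only [disp_mul] at h2
    rw [← sub_eq_iff_eq_add'.mpr h2.symm]
    abel
  rw [h]
  have hvw := mul_mem hv hw
  refine ⟨fun hc => comp_mem hvw hc, fun hc => ?_⟩
  have h3 := comp_mem (inv_mem hvw) hc
  convert h3 using 1
  ext x
  simp

theorem commutator_weightSubgroup_le [NeZero p] (s : ℕ) :
    ⁅weightSubgroup p n s, weightSubgroup p n 0⁆ ≤ weightSubgroup p n (s + 1) := by
  refine Subgroup.commutator_le.mpr fun w hw v hv => ?_
  refine (commutator_mem_weightSubgroup_iff (weightSubgroup_antitone s.zero_le hw) hv).mpr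
    fun k => Submodule.sub_mem _ ?_ ?_
  · exact filt_le (by omega) (comp_sub_mem (s := 0) hv (hw k))
  · exact filt_le (by omega) (comp_sub_mem (s := s) hw (hv k))

/-- The shear by `x_0 ^ (p - 1) ⋯ x_{j-1} ^ (p - 1)`, an element of weight one. -/
def topShear (p : ℕ) {n : ℕ} (j : Fin n) : Equiv.Perm (Fin n → ZMod p) :=
  shear p j (mono p (topExp p (j : ℕ)))

theorem mono_topExp_mem_filt [NeZero p] (j : Fin n) :
    mono p (topExp p (j : ℕ) : Fin n → ℕ) ∈ filt p n (p ^ (j : ℕ)) :=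
  mono_mem_filt (by have := wt_topExp (p := p) j.isLt.le; omega)

theorem disp_topShear_self [NeZero p] (j : Fin n) :
    disp (topShear p j) j = mono p (topExp p (j : ℕ)) :=
  disp_shear_self le_rfl (mono_topExp_mem_filt j)

theorem disp_topShear_of_ne {j : Fin n} (i : Fin n) (h : i ≠ j) : disp (topShear p j) i = 0 :=
  disp_shear_of_ne h _

theorem topShear_mem [NeZero p] (j : Fin n) : topShear p j ∈ weightSubgroup p n 0 :=
  shear_mem_weightSubgroup (mono_topExp_mem_filt j)

theorem commutator_shear [NeZero p] {j k : Fin n} (hjk : j < k) {g : (Fin n → ZMod p) → ZMod p}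
    (hg : g ∈ filt p n (p ^ (k : ℕ))) :
    ⁅(topShear p j)⁻¹, shear p k g⁆ = shear p k (g ∘ topShear p j - g) := by
  have hgc := comp_mem (topShear_mem j) hg
  have h : topShear p j * shear p k (g ∘ topShear p j) = shear p k g * topShear p j := by
    refine ext_disp fun i => ?_
    rw [disp_mul, disp_mul]
    by_cases hik : i = k
    · subst hik
      rw [disp_shear_self le_rfl hg, disp_shear_self le_rfl hgc,
        disp_topShear_of_ne _ hjk.ne']
      simp only [zero_add]
      exact add_zero _
    · rw [disp_shear_of_ne hik, disp_shear_of_ne hik]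
      by_cases hij : i = j
      · subst hij
        rw [disp_topShear_self, comp_eq_self le_rfl (NeZero.pos p) (mono_topExp_mem_filt i)
          fun l hl => disp_shear_of_ne (hl.trans hjk).ne _]
        exact add_comm _ _
      · rw [disp_topShear_of_ne _ hij]
        rfl
  rw [sub_eq_add_neg, shear_add, shear_neg, commutatorElement_def, inv_inv,
    mul_assoc (topShear p j)⁻¹, ← h, inv_mul_cancel_left]

/-- By descending induction on `s`: the leading term of a shear of weight `s + 1` is that of a
commutator of a shear of weight `s` with a generator `topShear`. -/
theorem weightSubgroup_le_commutator [Fact p.Prime] (s : ℕ) :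
    weightSubgroup p n (s + 1) ≤ ⁅weightSubgroup p n s, weightSubgroup p n 0⁆ := by
  rcases le_total (p ^ (n - 1)) s with hs | hs
  · rw [weightSubgroup_eq_bot (by omega)]
    exact bot_le
  induction hs using Nat.decreasingInduction with
  | self =>
    rw [weightSubgroup_eq_bot (by omega)]
    exact bot_le
  | of_succ s hs ih =>
    have ih' := ih.trans (Subgroup.commutator_mono (weightSubgroup_antitone s.le_succ) le_rfl)
    refine weightSubgroup_le fun k g hg => ?_
    obtain hk | ⟨d, hd⟩ : p ^ (k : ℕ) - (s + 1) = 0 ∨ ∃ d, p ^ (k : ℕ) - (s + 1) = d + 1 := by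
      rcases h : p ^ (k : ℕ) - (s + 1) with _ | d
      exacts [Or.inl rfl, Or.inr ⟨d, rfl⟩]
    · rw [hk, filt_zero, Submodule.mem_bot] at hg
      rw [hg, shear_zero]
      exact Subgroup.one_mem _
    · have hkn : p ^ (k : ℕ) ≤ p ^ n := Nat.pow_le_pow_right (NeZero.pos p) k.isLt.le
      obtain ⟨j, h, hj, hh, H⟩ := exists_comp_sub_sub_mem (p := p) (n := n) (d := d) (by omega)
      have hjk : j < k := by
        by_contra hjk
        have := Nat.pow_le_pow_right (NeZero.pos p) (show (k : ℕ) ≤ j from not_lt.mp hjk)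
        omega
      obtain ⟨c, hc⟩ := H (topShear p j) (disp_topShear_self j) disp_topShear_of_ne g
        (hd ▸ hg)
      have hch := Submodule.smul_mem _ c hh
      rw [show d + 2 = p ^ (k : ℕ) - s by omega] at hch
      have h1 : shear p k (c • (h ∘ topShear p j - h)) ∈
          ⁅weightSubgroup p n s, weightSubgroup p n 0⁆ := by
        have h2 : c • (h ∘ topShear p j - h) = (c • h) ∘ topShear p j - c • h := by
          ext x
          simp [mul_sub]
        rw [h2, ← commutator_shear hjk (filt_le (Nat.sub_le _ _) hch), Subgroup.commutator_comm]
        exact Subgroup.commutator_mem_commutator (inv_mem (topShear_mem j))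
          (shear_mem_weightSubgroup hch)
      have h3 : shear p k (g - c • (h ∘ topShear p j - h)) ∈
          ⁅weightSubgroup p n s, weightSubgroup p n 0⁆ :=
        ih' (shear_mem_weightSubgroup (filt_le (by omega) hc))
      have h4 := mul_mem h3 h1
      rwa [← shear_add, sub_add_cancel] at h4

theorem commutator_weightSubgroup [Fact p.Prime] (s : ℕ) :
    ⁅weightSubgroup p n s, weightSubgroup p n 0⁆ = weightSubgroup p n (s + 1) :=
  le_antisymm (commutator_weightSubgroup_le s) (weightSubgroup_le_commutator s)

/-- An element of weight greater than `s` whose commutators all have weight greater than `s + 2`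
has weight greater than `s + 1`. For a displacement that is not constant this is seen on the
commutator with a suitable `topShear`; a constant displacement of `x_k` is detected by the last
`topShear`, whose function involves `x_k`. -/
theorem mem_weightSubgroup_succ [Fact p.Prime] {s : ℕ} (hs : s + 2 ≤ p ^ (n - 1))
    {w : Equiv.Perm (Fin n → ZMod p)} (hw : w ∈ weightSubgroup p n s)
    (hc : ∀ u ∈ weightSubgroup p n 0, ⁅w, u⁆ ∈ weightSubgroup p n (s + 2)) :
    w ∈ weightSubgroup p n (s + 1) := by
  have hw0 := weightSubgroup_antitone s.zero_le hw
  have hpp := (Fact.out : p.Prime).one_lt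
  have hcu := fun j : Fin n => (commutator_mem_weightSubgroup_iff hw0 (topShear_mem j)).mp
    (hc _ (topShear_mem j))
  have hmain : ∀ k : Fin n, p ^ (k : ℕ) ≠ s + 1 → disp w k ∈ filt p n (p ^ (k : ℕ) - (s + 1)) := by
    intro k hk
    rcases Nat.lt_or_gt_of_ne hk with hk | hk
    · exact filt_le (by omega) (hw k)
    obtain ⟨d, hd⟩ : ∃ d, p ^ (k : ℕ) = d + 2 + s := ⟨p ^ (k : ℕ) - (s + 2), by omega⟩
    have hkn : p ^ (k : ℕ) ≤ p ^ n := Nat.pow_le_pow_right (NeZero.pos p) k.isLt.le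
    obtain ⟨j, hj, H⟩ := exists_mem_filt_of_comp_sub_mem (p := p) (n := n) (d := d) (by omega)
    have hjk : k ≠ j := by
      rintro rfl
      omega
    refine filt_le (by omega) (H (topShear p j) (disp_topShear_self j) disp_topShear_of_ne
      (topShear_mem j) _ (filt_le (by omega) (hw k)) ?_)
    have h1 := hcu j k
    rw [disp_topShear_of_ne k hjk] at h1
    have h2 : (0 : (Fin n → ZMod p) → ZMod p) ∘ w - 0 = 0 := by ext; simp
    rw [h2, sub_zero] at h1
    exact filt_le (by omega) h1
  intro k
  by_cases hk : p ^ (k : ℕ) = s + 1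
  swap
  · exact hmain k hk
  -- the displacement `g` of `x_k` is constant; it is split off as a shear `δ`
  set g := disp w k with hgdef
  have hg1 : g ∈ filt p n 1 := filt_le (by omega) (hw k)
  have hg : g ∈ filt p n (p ^ (k : ℕ)) := hw0 k
  have hconst : g = fun _ => g 0 := by
    ext x
    exact dependsOn_of_mem_filt (k := 0) (by simp) (NeZero.pos p) hg1 fun _ h => by
      simp at h
  have hn : 0 < n := k.pos
  set l : Fin n := ⟨n - 1, by omega⟩ with hl
  have hkl : k < l := by
    rcases (show k ≤ l from Nat.le_sub_one_of_lt k.isLt).lt_or_eq with h | h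
    · exact h
    · rw [h] at hk
      simp [hl] at hk
      omega
  have hll : p ^ (l : ℕ) = p ^ (n - 1) := rfl
  set δ := shear p k g with hδ
  have hδk : disp δ k = g := disp_shear_self le_rfl hg
  have hδ0 : δ ∈ weightSubgroup p n 0 := shear_mem_weightSubgroup hg
  have hw' : w * δ⁻¹ ∈ weightSubgroup p n (s + 1) := by
    rw [hδ, ← shear_neg]
    intro i
    rw [disp_mul]
    by_cases hi : i = k
    · subst hi
      rw [disp_shear_self le_rfl (Submodule.neg_mem _ hg), ← hgdef, hconst]
      convert Submodule.zero_mem _ using 1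
      ext x
      simp
    · rw [disp_shear_of_ne hi, zero_add]
      refine comp_mem ?_ (hmain i ?_)
      · exact shear_mem_weightSubgroup (s := 0) (Submodule.neg_mem _ hg)
      · rw [← hk]
        exact fun h => hi (Fin.ext (Nat.pow_right_injective hpp h))
  set T := mono p (topExp p (l : ℕ) : Fin n → ℕ) with hT
  have h1 := hcu l l
  rw [disp_topShear_self, ← hT] at h1
  have h2 := comp_sub_mem (s := 0) (topShear_mem l) (hmain l (by omega))
  have h3 : T ∘ w - T ∈ filt p n (p ^ (l : ℕ) - (s + 2)) := by
    have := Submodule.sub_mem _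
      (filt_le (by omega : _ ≤ p ^ (l : ℕ) - (s + 2)) h2) h1
    rwa [sub_sub_cancel] at this
  have h4 := comp_mem hδ0 (comp_sub_mem hw' (mono_topExp_mem_filt l))
  rw [← hT] at h4
  have h5 : T ∘ δ - T ∈ filt p n (p ^ (l : ℕ) - 1 - p ^ (k : ℕ)) := by
    have := Submodule.sub_mem _
      (filt_le (by omega : _ ≤ p ^ (l : ℕ) - 1 - p ^ (k : ℕ)) h3)
      (filt_le (by omega : p ^ (l : ℕ) - 1 - (s + 1) ≤ p ^ (l : ℕ) - 1 - p ^ (k : ℕ)) h4)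
    convert this using 1
    ext x
    simp
  have h6 := eq_zero_of_mono_comp_sub_mem hkl (hδk.trans hconst)
    (fun i hi => disp_shear_of_ne hi _) h5
  rw [hconst, h6]
  exact Submodule.zero_mem _

/-! ### The central series -/

theorem lowerCentralSeries_weightSubgroup [Fact p.Prime] (s : ℕ) :
    (weightSubgroup p n 0).lowerCentralSeries s = weightSubgroup p n s := by
  induction s with
  | zero => rfl
  | succ s ih => rw [Subgroup.lowerCentralSeries_succ, ih, commutator_weightSubgroup]

theorem upperCentralSeries_weightSubgroup [Fact p.Prime] {i : ℕ} (hi : i ≤ p ^ (n - 1)) :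
    (Subgroup.upperCentralSeries (weightSubgroup p n 0) i).map (weightSubgroup p n 0).subtype =
      weightSubgroup p n (p ^ (n - 1) - i) := by
  have key : ∀ x : weightSubgroup p n 0, x ∈ Subgroup.upperCentralSeries (weightSubgroup p n 0) i ↔
      (x : Equiv.Perm (Fin n → ZMod p)) ∈ weightSubgroup p n (p ^ (n - 1) - i) := by
    induction i with
    | zero =>
      intro x
      rw [Nat.sub_zero, weightSubgroup_eq_bot le_rfl]
      simp
    | succ i ih =>
      intro x
      rw [Subgroup.mem_upperCentralSeries_succ_iff]
      simp only [ih (by omega)]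
      constructor
      · intro h
        have hstep : ∀ t ≤ p ^ (n - 1) - (i + 1),
            (x : Equiv.Perm (Fin n → ZMod p)) ∈ weightSubgroup p n t := by
          intro t
          induction t with
          | zero => exact fun _ => x.2
          | succ t iht =>
            intro ht
            refine mem_weightSubgroup_succ (by omega) (iht (by omega)) fun u hu => ?_
            exact weightSubgroup_antitone (by omega : t + 2 ≤ p ^ (n - 1) - i) (h ⟨u, hu⟩)
        exact hstep _ le_rfl
      · intro h y
        have := commutator_weightSubgroup_le _ (Subgroup.commutator_mem_commutator h y.2)
        rwa [show p ^ (n - 1) - (i + 1) + 1 = p ^ (n - 1) - i by omega] at this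
  ext w
  rw [Subgroup.mem_map]
  constructor
  · rintro ⟨x, hx, rfl⟩
    exact (key x).mp hx
  · intro hw
    exact ⟨⟨w, weightSubgroup_antitone (Nat.zero_le _) hw⟩, (key _).mpr hw, rfl⟩

theorem map_upperCentralSeries_W [Fact p.Prime] {i : ℕ} (hi : i ≤ p ^ (n - 1)) :
    (Subgroup.upperCentralSeries (W p n) i).map (W p n).subtype =
      weightSubgroup p n (p ^ (n - 1) - i) := by
  rw [W_eq_weightSubgroup]
  exact upperCentralSeries_weightSubgroup hi

theorem upperCentralSeries_W [Fact p.Prime] {i : ℕ} (hi : i ≤ p ^ (n - 1)) :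
    Subgroup.upperCentralSeries (W p n) i =
      Subgroup.lowerCentralSeries (⊤ : Subgroup (W p n)) (p ^ (n - 1) - i) := by
  rw [← Subgroup.map_subtype_inj, map_upperCentralSeries_W hi,
    Subgroup.top_subtype_lowerCentralSeries, W_eq_weightSubgroup,
    lowerCentralSeries_weightSubgroup]

theorem weightSubgroup_ne_bot [Fact p.Prime] (hn : 1 ≤ n) {s : ℕ} (hs : s < p ^ (n - 1)) :
    weightSubgroup p n s ≠ ⊥ := by
  intro h
  have h1 := shear_mem_weightSubgroup (p := p) (s := s) (k := ⟨n - 1, by omega⟩)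
    (one_mem_filt (n := n) (Nat.sub_pos_of_lt hs))
  have h2 := disp_shear_self (k := ⟨n - 1, by omega⟩) (Nat.sub_le (p ^ (n - 1)) s)
    (one_mem_filt (p := p) (n := n) (Nat.sub_pos_of_lt hs))
  rw [h, Subgroup.mem_bot] at h1
  rw [h1, disp_one] at h2
  exact zero_ne_one (congrFun h2 0)

theorem isNilpotent_W [Fact p.Prime] : Group.IsNilpotent (W p n) :=
  ⟨p ^ (n - 1), by rw [upperCentralSeries_W le_rfl, Nat.sub_self]; rfl⟩

theorem nilpotencyClass_W [Fact p.Prime] (hn : 1 ≤ n) :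
    Group.nilpotencyClass (W p n) = p ^ (n - 1) := by
  have := isNilpotent_W (p := p) (n := n)
  refine eq_of_forall_ge_iff fun s => ?_
  rw [← Subgroup.lowerCentralSeries_eq_bot_iff_nilpotencyClass_le, ← Subgroup.map_subtype_inj,
    Subgroup.top_subtype_lowerCentralSeries, Subgroup.map_bot, W_eq_weightSubgroup,
    lowerCentralSeries_weightSubgroup]
  refine ⟨fun h => ?_, weightSubgroup_eq_bot⟩
  by_contra hs
  exact weightSubgroup_ne_bot hn (not_le.mp hs) h

/-! ### The order of the wreath product -/

theorem finrank_filt [Fact p.Prime] {d : ℕ} (hd : d ≤ p ^ n) :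
    Module.finrank (ZMod p) (filt p n d) = d := by
  have h := finrank_span_eq_card ((linearIndependent_mono (p := p) (n := n)).comp
    (Subtype.val : {e : Fin n → Fin p // wt p (fun j => (e j : ℕ)) < d} → _)
    Subtype.val_injective)
  rw [Set.range_comp, Subtype.range_coe_subtype] at h
  let e : {e : Fin n → Fin p // wt p (fun j => (e j : ℕ)) < d} ≃ Fin d :=
    (finFunctionFinEquiv.subtypeEquiv fun e => by rw [wt_val_eq]).trans (Fin.castLEquiv hd).symm
  rw [filt_eq_span_reduced]
  exact h.trans ((Fintype.card_congr e).trans (Fintype.card_fin d))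

/-- An element of the wreath product is given by its displacements, and every choice of functions
`f_k` of the coordinates before `k` occurs. -/
theorem card_W [Fact p.Prime] : Nat.card (W p n) = p ^ ∑ k ∈ Finset.range n, p ^ k := by
  let Φ : W p n → ∀ k : Fin n, filt p n (p ^ (k : ℕ)) := fun w k =>
    ⟨disp w k, W_eq_weightSubgroup.le w.2 k⟩
  have hΦ : Function.Bijective Φ := by
    constructor
    · intro w v h
      exact Subtype.ext (ext_disp fun k => congrArg Subtype.val (congrFun h k))
    · intro f
      have hinj : Function.Injective fun (x : Fin n → ZMod p) k => x k - (f k : _ → ZMod p) x := by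
        intro x y hxy
        ext k
        induction k using WellFoundedLT.induction with
        | _ k ih =>
          have h1 := congrFun hxy k
          have h2 : (f k : _ → ZMod p) x = (f k : _ → ZMod p) y :=
            dependsOn_of_mem_filt le_rfl (NeZero.pos p) (f k).2 fun i hi => ih i hi
          simpa [h2] using h1
      let w := Equiv.ofBijective _ (Finite.injective_iff_bijective.mp hinj)
      have hw : ∀ k, disp w k = f k := fun k => by
        ext x
        simp [disp, w]
      refine ⟨⟨w, ?_⟩, funext fun k => Subtype.ext (hw k)⟩
      rw [W_eq_weightSubgroup]
      intro k
      rw [hw]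
      exact (f k).2
  rw [Nat.card_eq_of_bijective Φ hΦ, Nat.card_pi]
  have h : ∀ k : Fin n, Nat.card (filt p n (p ^ (k : ℕ))) = p ^ p ^ (k : ℕ) := by
    intro k
    rw [Module.natCard_eq_pow_finrank (K := ZMod p), Nat.card_zmod,
      finrank_filt (Nat.pow_le_pow_right (NeZero.pos p) k.isLt.le)]
  simp only [h]
  rw [Finset.prod_pow_eq_pow_sum, Fin.sum_univ_eq_sum_range (fun k => p ^ k)]

theorem factorization_card_perm [Fact p.Prime] (α : Type*) [Finite α] (hα : Nat.card α = p ^ n) :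
    (Nat.card (Equiv.Perm α)).factorization p = ∑ k ∈ Finset.range n, p ^ k := by
  classical
  rw [Nat.card_perm, hα, Nat.factorization_def _ Fact.out]
  clear hα
  induction n with
  | zero => simp
  | succ n ih => rw [pow_succ', padicValNat_factorial_mul, ih, Finset.sum_range_succ]

end SylowCentral

/-- `Subgroup.lowerCentralSeries` is numbered from `0`, so that the classical `γ_j` is
`Subgroup.lowerCentralSeries ⊤ (j - 1)`. -/
theorem mainTheorem2 (p n : ℕ) [Fact p.Prime] (hp : Odd p) (hn : 1 ≤ n) :
    -- the upper and lower central series of a Sylow `p`-subgroup of `Sym(p ^ n)` coincide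
    (∀ P : Sylow p (Equiv.Perm (Fin (p ^ n))),
      Group.IsNilpotent P ∧ Group.nilpotencyClass P = p ^ (n - 1) ∧
      ∀ i ≤ p ^ (n - 1),
        Subgroup.upperCentralSeries P i =
          Subgroup.lowerCentralSeries (⊤ : Subgroup P) (p ^ (n - 1) - i)) ∧
    -- the iterated wreath product is such a Sylow subgroup
    (∃ P : Sylow p (Equiv.Perm (Fin n → ZMod p)),
      (P : Subgroup (Equiv.Perm (Fin n → ZMod p))) = SylowCentral.W p n) ∧
    -- the common terms of its two central series, in terms of `p`-degrees of monomials
    ∀ i ≤ p ^ (n - 1),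
      Subgroup.upperCentralSeries (SylowCentral.W p n) i =
        Subgroup.lowerCentralSeries (⊤ : Subgroup (SylowCentral.W p n)) (p ^ (n - 1) - i) ∧
      (Subgroup.upperCentralSeries (SylowCentral.W p n) i).map (SylowCentral.W p n).subtype =
        Subgroup.closure {w | ∃ (k : Fin n) (Λ : Fin k → Fin p),
          SylowCentral.pdeg p k Λ < i ∧ w = SylowCentral.monomialElt p k Λ} ∧
      ∀ k : Fin n,
        (Subgroup.upperCentralSeries (SylowCentral.W p n) i).map (SylowCentral.W p n).subtype ⊓
            SylowCentral.baseSubgroup p k =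
          Subgroup.closure {w | ∃ Λ : Fin k → Fin p,
            SylowCentral.pdeg p k Λ < i ∧ w = SylowCentral.monomialElt p k Λ} := by
  have hcard : Nat.card (Fin n → ZMod p) = p ^ n := by simp
  refine ⟨fun P => ?_, ⟨Sylow.ofCard (SylowCentral.W p n) ?_, Sylow.coe_ofCard _ _⟩,
    fun i hi => ⟨SylowCentral.upperCentralSeries_W hi, ?_, fun k => ?_⟩⟩
  · let ε : Equiv.Perm (Fin n → ZMod p) ≃* Equiv.Perm (Fin (p ^ n)) :=
      (Finite.equivFinOfCardEq hcard).permCongrHom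
    have hε : Nat.card ((SylowCentral.W p n).map (ε : _ →* Equiv.Perm (Fin (p ^ n)))) =
        p ^ (Nat.card (Equiv.Perm (Fin (p ^ n)))).factorization p := by
      rw [← Nat.card_congr (ε.subgroupMap (SylowCentral.W p n)).toEquiv, SylowCentral.card_W,
        SylowCentral.factorization_card_perm _ (Nat.card_fin _)]
    let e : SylowCentral.W p n ≃* P := (ε.subgroupMap _).trans <|
      (MulEquiv.subgroupCongr (Sylow.coe_ofCard _ hε).symm).trans ((Sylow.ofCard _ hε).equiv P)
    have hW := SylowCentral.isNilpotent_W (p := p) (n := n)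
    have hP : Group.IsNilpotent P := (Group.isNilpotent_congr e).mp hW
    have hseries : ∀ i ≤ p ^ (n - 1), Subgroup.upperCentralSeries P i =
        Subgroup.lowerCentralSeries (⊤ : Subgroup P) (p ^ (n - 1) - i) := by
      intro i hi
      rw [← Subgroup.comap_upperCentralSeries e.symm, SylowCentral.upperCentralSeries_W hi,
        Subgroup.comap_equiv_eq_map_symm, MulEquiv.symm_symm, Subgroup.map_lowerCentralSeries,
        Subgroup.map_top_of_surjective _ e.surjective]
    refine ⟨hP, ?_, hseries⟩
    rw [← SylowCentral.nilpotencyClass_W hn]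
    exact le_antisymm (Group.nilpotencyClass_le_of_surjective e.toMonoidHom e.surjective)
      (Group.nilpotencyClass_le_of_surjective e.symm.toMonoidHom e.symm.surjective)
  · rw [SylowCentral.card_W, SylowCentral.factorization_card_perm _ hcard]
  · rw [SylowCentral.map_upperCentralSeries_W hi, SylowCentral.weightSubgroup_eq_closure hi]
  · rw [SylowCentral.map_upperCentralSeries_W hi, SylowCentral.weightSubgroup_inf_baseSubgroup hi]
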